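/- Let $L$ be a non-trivial compact metrizable abelian topological group and let $I$ be an uncountable set with $|I|\le\mathfrak c$, where $\mathfrak c$ is the cardinality of the continuum. Equip $L^I$ with the product topology. Then $L^I$ contains a $G_\delta$-dense subgroup $D$ (that is, $D$ meets every non-empty $G_\delta$-subset of $L^I$) such that $|D|=\mathfrak c$ and all compact subsets of $D$ are countable; in particular, $D$ is not $w$-compact, i.e. no compact subset $C$ of $D$ satisfies $w(C)=w(D)$, where the weight $w(X)$ of a space $X$ is the least cardinality of a base of its topology. Furthermore, if $L$ is unbounded (that is, there is no integer $n\ge 1$ with $nx=0$ for all $x\in L$), then $D$ with all these properties can be chosen to be, in addition, a free abelian group. -/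

import Mathlib

open Cardinal TopologicalSpace

universe u v

/-- A subset `D` of a space is `G_δ`-dense if it meets every non-empty `G_δ`-subset. -/
def IsGδDense {X : Type u} [TopologicalSpace X] (D : Set X) : Prop :=
  ∀ B : Set X, IsGδ B → B.Nonempty → (D ∩ B).Nonempty

/-- The weight of a space: the least cardinality of a base of its topology. -/
noncomputable def topWeight (X : Type u) [TopologicalSpace X] : Cardinal.{u} :=
  sInf {κ : Cardinal.{u} | ∃ B : Set (Set X), IsTopologicalBasis B ∧ #B = κ}

/-- A space is `w`-compact if it has a compact subset (with the subspace topology) of the same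
weight as the whole space. -/
def WCompact (X : Type u) [TopologicalSpace X] : Prop :=
  ∃ C : Set X, IsCompact C ∧ topWeight C = topWeight X

/-!
Call a set totally imperfect if all its compact subsets are countable. A Bernstein set `B` in the
Cantor space `X` is totally imperfect and has size `𝔠`. Over a countable ring `R` acting faithfully
on `L`, the `L`-valued Dirac masses at the points of `B` are linearly independent vectors of a
countable power of `L`, and their span is again totally imperfect: the points where the elements of
a compact set have a prescribed non-zero mass, isolated by a prescribed clopen set, form a compact
subset of `B`, and there are only countably many prescriptions.

Now let `I` be uncountable and identify `L ^ I` with `M ^ I`, where `M` is that countable power.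
There are `𝔠` functions from a countable subset of `I` to `M`; extend each of them to all of `I` by
a constant, a Dirac mass of its own. The extensions form a `G_δ`-dense set. The elements of their
span are constant off a countable set, and the eventual value is injective on the span. On a compact
subset of the span it is given by a single coordinate, so that this subset is mapped injectively
onto a compact set in the span of the Dirac masses, hence is countable.

Finally, a `G_δ`-dense subspace of an uncountable product is not first countable, whereas countable
compact Hausdorff spaces are second countable, so the two have different weights. The ring is `ℤ`
if `L` is unbounded, and the image of `ℤ` in the endomorphisms of `L` in general.
-/

theorem exists_injective_choice {ι : Type u} {X : Type v} (A : ι → Set X)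
    (hA : ∀ i, lift.{v} #ι ≤ lift.{u} #(A i)) :
    ∃ f : ι → X, f.Injective ∧ ∀ i, f i ∈ A i := by
  obtain ⟨_, _, hι⟩ := exists_ord_eq_type_lt ι
  have exists_fresh (i : ι) (g : Set.Iio i → X) : ∃ x ∈ A i, x ∉ Set.range g := by
    by_contra! h
    have hle : lift.{u} #(A i) ≤ lift.{v} #(Set.Iio i) :=
      (lift_le.2 (mk_le_mk_of_subset h)).trans mk_range_le_lift
    exact ((hA i).trans hle).not_gt (lift_lt.2 (mk_Iio_lt i hι))
  choose F hFA hF using exists_fresh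
  let f : ι → X := wellFounded_lt.fix fun i g => F i fun j => g j j.2
  have hf (i : ι) : f i = F i fun j => f j := wellFounded_lt.fix_eq _ i
  have hne {i j : ι} (hij : i < j) (h : f i = f j) : False :=
    hF j (fun k => f k) ⟨⟨i, hij⟩, h.trans (hf j)⟩
  exact ⟨f, fun i j h => le_antisymm (not_lt.1 fun hji => hne hji h.symm)
    (not_lt.1 fun hij => hne hij h), fun i => hf i ▸ hFA i _⟩

section TotallyImperfect

variable {X : Type u} {Y : Type v} [TopologicalSpace X] [TopologicalSpace Y]

/-- A set is totally imperfect if all its compact subsets are countable. For subsets of a Polish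
space this says that the set contains no non-empty perfect subset. -/
def TotallyImperfect (S : Set X) : Prop :=
  ∀ K ⊆ S, IsCompact K → K.Countable

theorem TotallyImperfect.mono {S T : Set X} (hT : TotallyImperfect T) (h : S ⊆ T) :
    TotallyImperfect S :=
  fun K hKS => hT K (hKS.trans h)

theorem TotallyImperfect.of_injOn {S : Set X} {T : Set Y} (hT : TotallyImperfect T) {f : X → Y}
    (hf : Continuous f) (hST : Set.MapsTo f S T) (hinj : Set.InjOn f S) : TotallyImperfect S :=
  fun K hKS hK => Set.countable_of_injective_of_countable_image (hinj.mono hKS)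
    (hT (f '' K) (Set.image_subset_iff.2 (hST.mono_left hKS)) (hK.image hf))

theorem TotallyImperfect.countable_of_isCompact {S : Set X} (hS : TotallyImperfect S) {C : Set S}
    (hC : IsCompact C) : C.Countable :=
  (hS.of_injOn (S := Set.univ) continuous_subtype_val (fun x _ => x.2)
    Subtype.val_injective.injOn) C (Set.subset_univ C) hC

theorem mk_closeds_le_continuum [SecondCountableTopology X] : #(Closeds X) ≤ 𝔠 := by
  have hinj : Function.Injective fun K : Closeds X =>
      {B : countableBasis X | (B : Set X) ⊆ (K : Set X)ᶜ} := fun K K' h =>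
    SetLike.coe_injective <| compl_injective <|
      (isBasis_countableBasis X).eq_of_forall_subset_iff K.isClosed.isOpen_compl
        K'.isClosed.isOpen_compl fun B hB => Set.ext_iff.1 h ⟨B, hB⟩
  calc #(Closeds X) ≤ #(Set (countableBasis X)) := mk_le_of_injective hinj
    _ = 2 ^ #(countableBasis X) := mk_set
    _ ≤ 2 ^ ℵ₀ := power_le_power_left two_ne_zero (countable_countableBasis X).le_aleph0
    _ = 𝔠 := two_power_aleph0

theorem mk_le_continuum_of_secondCountable [T0Space X] [SecondCountableTopology X] : #X ≤ 𝔠 := by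
  have hinj : Function.Injective fun x : X => Closeds.closure {x} := fun x y hxy =>
    (inseparable_iff_closure_eq.2 (congrArg SetLike.coe hxy)).eq
  exact (mk_le_of_injective hinj).trans mk_closeds_le_continuum

theorem continuum_le_mk_of_isClosed [PolishSpace X] {K : Set X} (hK : IsClosed K)
    (hK' : ¬ K.Countable) : 𝔠 ≤ #K := by
  obtain ⟨g, hgK, -, hg⟩ := hK.exists_nat_bool_injection_of_not_countable hK'
  calc 𝔠 = lift.{u} #(ℕ → Bool) := by simp
    _ = lift.{0} #(Set.range g) := (mk_range_eq_of_injective hg).symm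
    _ ≤ #K := by rw [lift_uzero]; exact mk_le_mk_of_subset hgK

theorem exists_totallyImperfect_continuum_le_mk [PolishSpace X] [Uncountable X] :
    ∃ B : Set X, TotallyImperfect B ∧ 𝔠 ≤ #B := by
  -- The summand `𝒦` makes the complement of `B` meet every uncountable compact set, and the
  -- summand `X` makes `B` large.
  let 𝒦 := {K : Closeds X // ¬ (K : Set X).Countable}
  have h𝒦 : #(𝒦 ⊕ X) ≤ 𝔠 := by
    rw [← add_def, ← continuum_add_self]
    exact add_le_add ((mk_subtype_le _).trans mk_closeds_le_continuum)
      mk_le_continuum_of_secondCountable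
  obtain ⟨f, hf, hfA⟩ := exists_injective_choice
    (Sum.elim (fun K : 𝒦 => (K.1 : Set X)) fun _ : X => Set.univ) (by
      rintro (K | x) <;> refine lift_le.2 (h𝒦.trans ?_)
      · exact (continuum_le_mk_of_isClosed K.1.isClosed K.2)
      · exact (continuum_le_mk_of_isClosed isClosed_univ Set.not_countable_univ))
  refine ⟨Set.range (f ∘ Sum.inr), fun K hKB hK => ?_, ?_⟩
  · by_contra hunc
    obtain ⟨x, hx⟩ := hKB (hfA (Sum.inl ⟨⟨K, hK.isClosed⟩, hunc⟩))
    exact Sum.inr_ne_inl (hf hx)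
  · rw [mk_range_eq _ (hf.comp Sum.inr_injective), ← mk_univ]
    exact continuum_le_mk_of_isClosed isClosed_univ Set.not_countable_univ

end TotallyImperfect

section IsGδDense

theorem IsGδDense.mono {X : Type*} [TopologicalSpace X] {D D' : Set X} (hD : IsGδDense D)
    (h : D ⊆ D') : IsGδDense D' :=
  fun B hB hne => (hD B hB hne).mono (Set.inter_subset_inter_left B h)

theorem IsGδDense.image {X Y : Type*} [TopologicalSpace X] [TopologicalSpace Y] {D : Set X}
    (hD : IsGδDense D) {f : X → Y} (hf : Continuous f) (hsurj : f.Surjective) :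
    IsGδDense (f '' D) := fun B hB hne => by
  obtain ⟨x, hxD, hxB⟩ := hD (f ⁻¹' B) (hB.preimage hf) (hne.preimage hsurj)
  exact ⟨f x, Set.mem_image_of_mem f hxD, hxB⟩

theorem exists_isGδ_preimage_val_eq {X : Type*} [TopologicalSpace X] {D : Set X} {s : Set D}
    (hs : IsGδ s) : ∃ B : Set X, IsGδ B ∧ Subtype.val ⁻¹' B = s := by
  obtain ⟨U, hU, rfl⟩ := hs.eq_iInter_nat
  choose V hV hVU using fun n => isOpen_induced_iff.1 (hU n)
  exact ⟨⋂ n, V n, .iInter_of_isOpen hV, by simp only [Set.preimage_iInter, hVU]⟩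

variable {I : Type v} {L : Type u} [TopologicalSpace L]

theorem exists_countable_forall_eqOn_mem {B : Set (I → L)} (hB : IsGδ B) {y : I → L} (hy : y ∈ B) :
    ∃ J : Set I, J.Countable ∧ ∀ x, Set.EqOn x y J → x ∈ B := by
  obtain ⟨U, hU, rfl⟩ := hB.eq_iInter_nat
  have exists_finset (n : ℕ) : ∃ F : Finset I, ∀ x, Set.EqOn x y F → x ∈ U n := by
    obtain ⟨F, u, hu, hFU⟩ := isOpen_pi_iff.1 (hU n) y (Set.mem_iInter.1 hy n)
    exact ⟨F, fun x hx => hFU fun i hi => hx hi ▸ (hu i hi).2⟩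
  choose F hF using exists_finset
  exact ⟨⋃ n, F n, Set.countable_iUnion fun n => (F n).countable_toSet, fun x hx =>
    Set.mem_iInter.2 fun n => hF n x (hx.mono (Set.subset_iUnion (fun n => (F n : Set I)) n))⟩

theorem isGδDense_of_forall_exists_eqOn {D : Set (I → L)}
    (hD : ∀ J : Set I, J.Countable → ∀ y : I → L, ∃ d ∈ D, Set.EqOn d y J) : IsGδDense D := by
  rintro B hB ⟨y, hy⟩
  obtain ⟨J, hJ, hJB⟩ := exists_countable_forall_eqOn_mem hB hy
  obtain ⟨d, hdD, hd⟩ := hD J hJ y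
  exact ⟨d, hdD, hJB d hd⟩

variable [T1Space L] [FirstCountableTopology L]

theorem isGδ_setOf_eqOn {J : Set I} (hJ : J.Countable) (y : I → L) :
    IsGδ {x : I → L | Set.EqOn x y J} := by
  have : {x : I → L | Set.EqOn x y J} = ⋂ i ∈ J, (fun x => x i) ⁻¹' {y i} := by
    ext x
    simp [Set.EqOn]
  exact this ▸ .biInter hJ fun i _ => (IsGδ.singleton (y i)).preimage (continuous_apply i)

theorem IsGδDense.exists_eqOn {D : Set (I → L)} (hD : IsGδDense D) {J : Set I} (hJ : J.Countable)
    (y : I → L) : ∃ d ∈ D, Set.EqOn d y J :=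
  hD _ (isGδ_setOf_eqOn hJ y) ⟨y, Set.eqOn_refl y J⟩

theorem IsGδDense.continuum_le_mk [Infinite I] [Nontrivial L] {D : Set (I → L)}
    (hD : IsGδDense D) : 𝔠 ≤ #D := by
  obtain ⟨a, b, hab⟩ := exists_pair_ne L
  let ν := Infinite.natEmbedding I
  choose d hdD hd using fun s : ℕ → Bool => hD.exists_eqOn (Set.countable_range ν)
    (Function.extend ν (fun n => bif s n then a else b) fun _ => a)
  have hdν (s : ℕ → Bool) (n : ℕ) : d s (ν n) = bif s n then a else b := by
    rw [hd s ⟨n, rfl⟩, ν.injective.extend_apply]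
  have hinj : Function.Injective fun s => (⟨d s, hdD s⟩ : D) := by
    intro s t hst
    have hst' : d s = d t := congrArg Subtype.val hst
    ext1 n
    have : (bif s n then a else b) = bif t n then a else b := by rw [← hdν, ← hdν, hst']
    cases hs : s n <;> cases ht : t n <;> simp_all [hab.symm]
  simpa using lift_mk_le_lift_mk_of_injective hinj

theorem IsGδDense.not_firstCountableTopology [Uncountable I] [Nontrivial L] {D : Set (I → L)}
    (hD : IsGδDense D) : ¬ FirstCountableTopology D := by
  classical
  intro hfc
  obtain ⟨y, hy, -⟩ := hD.exists_eqOn Set.countable_empty fun _ => Classical.arbitrary L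
  obtain ⟨B, hB, hBy⟩ := exists_isGδ_preimage_val_eq (IsGδ.singleton (⟨y, hy⟩ : D))
  have hyB : y ∈ B := hBy.ge rfl
  obtain ⟨J, hJ, hJB⟩ := exists_countable_forall_eqOn_mem hB hyB
  obtain ⟨i, hi⟩ : Jᶜ.Nonempty := Set.nonempty_compl.2 fun h => Set.not_countable_univ (h ▸ hJ)
  obtain ⟨a, ha⟩ := exists_ne (y i)
  obtain ⟨d, hdD, hd⟩ := hD.exists_eqOn (hJ.insert i) (Function.update y i a)
  have hdB : d ∈ B := hJB d fun j hj => by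
    rw [hd (Set.mem_insert_of_mem i hj), Function.update_of_ne (ne_of_mem_of_not_mem hj hi)]
  have hdy : d = y := congrArg Subtype.val (hBy.le hdB : (⟨d, hdD⟩ : D) = ⟨y, hy⟩)
  have hdi := hd (Set.mem_insert i J)
  rw [hdy, Function.update_self] at hdi
  exact ha hdi.symm

end IsGδDense

section WCompact

theorem topWeight_le_aleph0_iff {X : Type u} [TopologicalSpace X] :
    topWeight X ≤ ℵ₀ ↔ SecondCountableTopology X := by
  constructor
  · intro h
    obtain ⟨B, hB, hBc⟩ : topWeight X ∈
        {κ : Cardinal.{u} | ∃ B : Set (Set X), IsTopologicalBasis B ∧ #B = κ} :=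
      csInf_mem ⟨_, _, isTopologicalBasis_opens, rfl⟩
    exact hB.secondCountableTopology (le_aleph0_iff_set_countable.1 (hBc.trans_le h))
  · intro h
    have hle : topWeight X ≤ #(countableBasis X) :=
      csInf_le' ⟨_, isBasis_countableBasis X, rfl⟩
    exact hle.trans (countable_countableBasis X).le_aleph0

theorem secondCountableTopology_of_countable_of_compactSpace {X : Type*} [TopologicalSpace X]
    [CompactSpace X] [T2Space X] [Countable X] : SecondCountableTopology X := by
  have separation (x y : X) : ∃ f : X → ℝ, Continuous f ∧ (x ≠ y → f x ≠ f y) := by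
    by_cases hxy : x = y
    · exact ⟨0, continuous_zero, fun h => (h hxy).elim⟩
    · obtain ⟨f, hfx, hfy, -⟩ := exists_continuous_zero_one_of_isClosed
        (isClosed_singleton (x := x)) (isClosed_singleton (x := y)) (by simpa)
      refine ⟨f, f.continuous, fun _ => ?_⟩
      simp [hfx rfl, hfy rfl]
  choose f hf hfne using separation
  let F : X → X × X → ℝ := fun z a => f a.1 a.2 z
  have hF : Continuous F := by fun_prop
  have hFinj : F.Injective := fun x y hxy => by
    by_contra hne
    exact hfne x y hne (congrFun hxy (x, y))
  exact (hF.isClosedEmbedding hFinj).isEmbedding.secondCountableTopology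

theorem not_wCompact_of_not_secondCountableTopology {X : Type*} [TopologicalSpace X] [T2Space X]
    (hX : ∀ C : Set X, IsCompact C → C.Countable) (hX' : ¬ SecondCountableTopology X) :
    ¬ WCompact X := by
  rintro ⟨C, hC, hCX⟩
  have : Countable C := (hX C hC).to_subtype
  have : CompactSpace C := isCompact_iff_compactSpace.1 hC
  have hC2 : SecondCountableTopology C := secondCountableTopology_of_countable_of_compactSpace
  exact hX' (topWeight_le_aleph0_iff.1 (hCX ▸ topWeight_le_aleph0_iff.2 hC2))

end WCompact

section EventuallyConst

open Filter

section LinearCombination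

variable {R M I Q : Type*} [Semiring R] [AddCommMonoid M] [Module R M] {l : Filter I}

theorem eventually_linearCombination_apply_eq {b : Q → M} {u : Q → I → M}
    (hub : ∀ q, ∀ᶠ i in l, u q i = b q) (p : Q →₀ R) :
    ∀ᶠ i in l, Finsupp.linearCombination R u p i = Finsupp.linearCombination R b p := by
  filter_upwards [(eventually_all_finset p.support).2 fun q _ => hub q] with i hi
  simp only [Finsupp.linearCombination_apply, Finsupp.sum, Finset.sum_apply, Pi.smul_apply]
  exact Finset.sum_congr rfl fun q hq => by rw [hi q hq]

theorem linearIndependent_of_eventually_eq [l.NeBot] {b : Q → M} (hb : LinearIndependent R b)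
    {u : Q → I → M} (hub : ∀ q, ∀ᶠ i in l, u q i = b q) :
    LinearIndependent R u := by
  intro p p' h
  obtain ⟨i, hi, hi'⟩ := ((eventually_linearCombination_apply_eq hub p).and
    (eventually_linearCombination_apply_eq hub p')).exists
  exact hb (hi.symm.trans ((congrFun h i).trans hi'))

end LinearCombination

variable {I M : Type*} [TopologicalSpace M] [T2Space M] [SecondCountableTopology M]
  {l : Filter I} [l.NeBot] [CountableInterFilter l]

theorem exists_forall_apply_eq_of_isCompact {C : Set (I → M)} (hC : IsCompact C)
    {ev : (I → M) → M} (hev : ∀ d ∈ C, ∀ᶠ i in l, d i = ev d) (hinj : C.InjOn ev) :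
    ∃ i, ∀ d ∈ C, d i = ev d := by
  obtain ⟨t, ht, htd⟩ := exists_countable_dense (ev '' C)
  choose r hrC hr using fun y : ev '' C => y.2
  have hT : ∀ᶠ i in l, ∀ y ∈ t, r y i = y :=
    (eventually_countable_ball ht).2 fun y _ => (hev _ (hrC y)).mono fun i hi => hi.trans (hr y)
  let T := {i | ∀ y ∈ t, r y i = y}
  let C' := C ∩ {d | ∀ i ∈ T, ∀ j ∈ T, d i = d j}
  have hC' : IsCompact C' := hC.inter_right <| by
    simp only [Set.ofPred_forall]
    exact isClosed_biInter fun i _ => isClosed_biInter fun j _ =>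
      isClosed_eq (continuous_apply i) (continuous_apply j)
  have eq_ev {d : I → M} (hd : d ∈ C') {i : I} (hi : i ∈ T) : d i = ev d := by
    obtain ⟨j, hj, hdj⟩ := (hT.and (hev d hd.1)).exists
    exact (hd.2 i hi j hj).trans hdj
  obtain ⟨i, hi⟩ := hT.exists
  -- The representatives `r y` lie in `C'`, so by density and compactness `C'` realizes all
  -- eventual values, and injectivity of `ev` gives `C = C'`.
  have hsub : ev '' C ⊆ (· i) '' C' := by
    intro y hy
    have hty : Subtype.val '' t ⊆ (· i) '' C' := by
      rintro _ ⟨y, hy, rfl⟩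
      exact ⟨r y, ⟨hrC y, fun j hj k hk => (hj y hy).trans (hk y hy).symm⟩, hi y hy⟩
    exact closure_minimal hty (hC'.image (continuous_apply i)).isClosed
      (image_closure_subset_closure_image continuous_subtype_val ⟨⟨y, hy⟩, htd _, rfl⟩)
  refine ⟨i, fun d hd => ?_⟩
  obtain ⟨d', hd', hd'i⟩ := hsub ⟨d, hd, rfl⟩
  obtain rfl : d' = d := hinj hd'.1 hd ((eq_ev hd' hi).symm.trans hd'i)
  exact hd'i

theorem TotallyImperfect.of_eventually_eq {H : Set M} (hH : TotallyImperfect H)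
    {S : Set (I → M)} {ev : (I → M) → M} (hev : ∀ d ∈ S, ∀ᶠ i in l, d i = ev d)
    (hSH : Set.MapsTo ev S H) (hinj : S.InjOn ev) : TotallyImperfect S := by
  intro C hCS hC
  obtain ⟨i, hi⟩ :=
    exists_forall_apply_eq_of_isCompact hC (fun d hd => hev d (hCS hd)) (hinj.mono hCS)
  have hevC : IsCompact (ev '' C) := Set.image_congr hi ▸ hC.image (continuous_apply i)
  exact Set.countable_of_injective_of_countable_image (hinj.mono hCS)
    (hH _ (Set.image_subset_iff.2 (hSH.mono_left hCS)) hevC)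

theorem totallyImperfect_span_range_of_eventually_eq {R Q : Type*} [Semiring R]
    [AddCommMonoid M] [Module R M] {b : Q → M} (hb : LinearIndependent R b)
    (hbH : TotallyImperfect (Submodule.span R (Set.range b) : Set M)) {u : Q → I → M}
    (hub : ∀ q, ∀ᶠ i in l, u q i = b q) :
    TotallyImperfect (Submodule.span R (Set.range u) : Set (I → M)) := by
  choose! p hp using fun x (hx : x ∈ Submodule.span R (Set.range u)) =>
    Finsupp.mem_span_range_iff_exists_finsupp.1 hx
  refine hbH.of_eventually_eq (l := l) (ev := fun x => Finsupp.linearCombination R b (p x))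
    (fun x hx => ?_) (fun x _ => ?_) fun x hx x' hx' h => ?_
  · have := eventually_linearCombination_apply_eq hub (p x)
    rwa [Finsupp.linearCombination_apply, hp x hx] at this
  · exact Finsupp.mem_span_range_iff_exists_finsupp.2 ⟨p x, rfl⟩
  · rw [← hp x hx, ← hp x' hx', hb h]

theorem exists_isGδDense_totallyImperfect_span {R : Type*} [Semiring R] [AddCommMonoid M]
    [Module R M] [Uncountable I] {b : (ℕ → I) × (ℕ → M) → M}
    (hb : LinearIndependent R b) (hbH : TotallyImperfect (Submodule.span R (Set.range b) : Set M)) :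
    ∃ u : (ℕ → I) × (ℕ → M) → I → M, LinearIndependent R u ∧ IsGδDense (Set.range u) ∧
      TotallyImperfect (Submodule.span R (Set.range u) : Set (I → M)) := by
  have : CountableInterFilter (cocountable : Filter I) :=
    CardinalInterFilter.toCountableInterFilter _ aleph0_lt_aleph_one
  have : (cocountable : Filter I).NeBot := by
    rw [neBot_iff, Ne, ← empty_mem_iff_bot, mem_cocountable, Set.compl_empty]
    exact Set.not_countable_univ
  let u (q : (ℕ → I) × (ℕ → M)) : I → M := Function.extend q.1 q.2 fun _ => b q
  have hub (q) : ∀ᶠ i in cocountable, u q i = b q := by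
    have hq : (Set.range q.1)ᶜ ∈ cocountable := by
      rw [mem_cocountable, compl_compl]
      exact Set.countable_range q.1
    exact mem_of_superset hq fun i hi => Function.extend_apply' _ _ i hi
  refine ⟨u, linearIndependent_of_eventually_eq hb hub,
    isGδDense_of_forall_exists_eqOn fun J hJ y => ?_,
    totallyImperfect_span_range_of_eventually_eq hb hbH hub⟩
  obtain ⟨f, hJf⟩ := Set.countable_iff_exists_subset_range.1 hJ
  refine ⟨u (f, y ∘ f), Set.mem_range_self _, fun i hi => ?_⟩
  obtain ⟨n, rfl⟩ := hJf hi
  exact Function.FactorsThrough.extend_apply (fun m n h => congrArg y h) _ n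

end EventuallyConst

section Dirac

variable {R L X κ : Type*} [TopologicalSpace X]

section Zero

variable [Zero L]

/-- The Dirac mass `z` at `s` as an element of a power of `L`: the coordinate indexed by `k` and a
clopen set `U` is the mass of `U` under the point mass `z k` at `s`. A family of masses is needed
because `L` may have no single element that is annihilated by no non-zero scalar. -/
noncomputable def diracVec (z : κ → L) (s : X) : κ × Clopens X → L :=
  fun n => (n.2 : Set X).indicator (fun _ => z n.1) s

/-- The vector `m`, read as a family of `L`-valued set functions, agrees with the Dirac mass `z`
at `s` on the clopen subsets of `U`. -/
def IsDiracOn (z : κ → L) (U : Clopens X) (s : X) (m : κ × Clopens X → L) : Prop :=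
  ∀ V ≤ U, ∀ k, m (k, V) = diracVec z s (k, V)

variable (z : κ → L)

theorem diracVec_of_mem {s : X} {U : Clopens X} (hs : s ∈ U) (k : κ) :
    diracVec z s (k, U) = z k :=
  Set.indicator_of_mem (SetLike.mem_coe.2 hs) _

theorem diracVec_of_notMem {s : X} {U : Clopens X} (hs : s ∉ U) (k : κ) :
    diracVec z s (k, U) = 0 :=
  Set.indicator_of_notMem (fun h => hs (SetLike.mem_coe.1 h)) _

theorem IsDiracOn.eq_of_mem {z z' : κ → L} {U U' : Clopens X} {s : X} {m : κ × Clopens X → L}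
    (h : IsDiracOn z U s m) (h' : IsDiracOn z' U' s m) (hs : s ∈ U) (hs' : s ∈ U') : z = z' := by
  ext k
  have hmem : s ∈ U ⊓ U' := ⟨hs, hs'⟩
  rw [← diracVec_of_mem z hmem, ← h _ inf_le_left, h' _ inf_le_right, diracVec_of_mem z' hmem]

variable [TopologicalSpace L]

theorem continuous_diracVec : Continuous (diracVec z : X → κ × Clopens X → L) :=
  continuous_pi fun n => continuous_const.indicator (by simp [n.2.isClopen.frontier_eq])

theorem isClosed_setOf_isDiracOn [T2Space L] (U : Clopens X) :
    IsClosed {x : X × (κ × Clopens X → L) | IsDiracOn z U x.1 x.2} := by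
  simp only [IsDiracOn, Set.ofPred_forall]
  have := continuous_diracVec (X := X) z
  exact isClosed_iInter fun V => isClosed_iInter fun _ => isClosed_iInter fun k =>
    isClosed_eq (by fun_prop) (by fun_prop)

theorem isCompact_setOf_exists_isDiracOn [T2Space L] [CompactSpace X] (U : Clopens X)
    {K : Set (κ × Clopens X → L)} (hK : IsCompact K) :
    IsCompact {s | s ∈ U ∧ ∃ m ∈ K, IsDiracOn z U s m} := by
  have hcomp := ((U.isClopen.isClosed.isCompact.prod hK).inter_right
    (isClosed_setOf_isDiracOn z U)).image continuous_fst
  convert hcomp using 1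
  ext s
  simp [and_assoc]

end Zero

variable [Ring R] [AddCommGroup L] [Module R L]

theorem linearCombination_diracVec_apply (z : κ → L) (p : X →₀ R) (n : κ × Clopens X) :
    Finsupp.linearCombination R (diracVec z) p n =
      ∑ s ∈ p.support, diracVec (p s • z) s n := by
  simp [Finsupp.linearCombination_apply, Finsupp.sum, diracVec, Set.indicator_smul_apply]

variable [CompactSpace X] [T2Space X] [TotallyDisconnectedSpace X]

theorem exists_isDiracOn_linearCombination (z : κ → L) (p : X →₀ R) (s : X) :
    ∃ U : Clopens X, s ∈ U ∧
      IsDiracOn (p s • z) U s (Finsupp.linearCombination R (diracVec z) p) := by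
  classical
  obtain ⟨U, hU, hsU, hUp⟩ := compact_exists_isClopen_in_isOpen
    (p.support.erase s).finite_toSet.isClosed.isOpen_compl
    (show s ∈ (↑(p.support.erase s) : Set X)ᶜ by simp)
  refine ⟨⟨U, hU⟩, hsU, fun V hVU k => ?_⟩
  rw [linearCombination_diracVec_apply]
  refine Finset.sum_eq_single s (fun t ht hts => ?_) fun hs => ?_
  · exact diracVec_of_notMem _ (fun h => hUp (hVU h) (by simpa [hts] using ht)) k
  · simp [Finsupp.notMem_support_iff.1 hs, diracVec]

variable {z : κ → L} (hz : ∀ r : R, r • z = 0 → r = 0)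

include hz

theorem mem_support_of_isDiracOn {U : Clopens X} {a : R} (ha : a ≠ 0) {s : X} {p : X →₀ R}
    (hs : s ∈ U) (h : IsDiracOn (a • z) U s (Finsupp.linearCombination R (diracVec z) p)) :
    s ∈ p.support := by
  obtain ⟨V, hsV, hV⟩ := exists_isDiracOn_linearCombination z p s
  rw [Finsupp.mem_support_iff]
  intro hps
  rw [hps, zero_smul] at hV
  exact ha (hz a (h.eq_of_mem hV hs hsV))

theorem linearIndependent_diracVec :
    LinearIndependent R (diracVec z : X → κ × Clopens X → L) := by
  refine linearIndependent_iff.2 fun p hp => Finsupp.ext fun s => hz _ ?_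
  obtain ⟨U, hsU, hU⟩ := exists_isDiracOn_linearCombination z p s
  rw [hp] at hU
  have hzero : IsDiracOn (0 : κ → L) U s 0 := fun V _ k => by simp [diracVec]
  exact hU.eq_of_mem hzero hsU hsU

variable [SecondCountableTopology X] [Countable R] [TopologicalSpace L] [T2Space L]

theorem totallyImperfect_span_diracVec {B : Set X} (hB : TotallyImperfect B) :
    TotallyImperfect
      (Submodule.span R (diracVec z '' B) : Set (κ × Clopens X → L)) := by
  intro K hKB hK
  have : Countable (Clopens X) := Clopens.countable_iff_secondCountable.2 inferInstance
  let S (U : Clopens X) (a : R) : Set X := {s | s ∈ U ∧ ∃ m ∈ K, IsDiracOn (a • z) U s m}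
  have hS (U : Clopens X) (a : R) (ha : a ≠ 0) : (S U a).Countable := by
    refine hB _ ?_ (isCompact_setOf_exists_isDiracOn (a • z) U hK)
    rintro s ⟨hs, m, hm, hms⟩
    obtain ⟨p, hp, rfl⟩ := (Finsupp.mem_span_image_iff_linearCombination R).1 (hKB hm)
    exact hp (mem_support_of_isDiracOn hz ha hs hms)
  let T : Set X := ⋃ (U : Clopens X) (a : R) (_ : a ≠ 0), S U a
  have hT : Countable T := (Set.countable_iUnion fun U => Set.countable_iUnion fun a =>
    Set.countable_iUnion (hS U a)).to_subtype
  have hKT : K ⊆ Submodule.span R (diracVec z '' T) := by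
    intro m hm
    obtain ⟨p, -, rfl⟩ := (Finsupp.mem_span_image_iff_linearCombination R).1 (hKB hm)
    refine (Finsupp.mem_span_image_iff_linearCombination R).2 ⟨p, fun s hs => ?_, rfl⟩
    obtain ⟨U, hsU, hU⟩ := exists_isDiracOn_linearCombination z p s
    simp only [T, Set.mem_iUnion]
    exact ⟨U, p s, Finsupp.mem_support_iff.1 hs, hsU, _, hm, hU⟩
  have hspan : Countable (Submodule.span R (diracVec z '' T)) := by
    rw [Set.image_eq_range]
    infer_instance
  exact (Set.countable_coe_iff.1 hspan).mono hKT

end Dirac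

section Cardinality

theorem mk_fun_le_continuum {ι : Type u} {A : Type v} [Countable ι] (hA : #A ≤ 𝔠) :
    #(ι → A) ≤ 𝔠 := by
  rw [mk_pi, prod_const, ← continuum_power_aleph0]
  exact (power_le_power_right (lift_le_continuum.2 hA)).trans
    (power_le_power_left continuum_ne_zero (lift_le_aleph0.2 mk_le_aleph0))

theorem mk_span_range_le_continuum {R M : Type*} {Q : Type u} [Semiring R] [Countable R]
    [AddCommMonoid M] [Module R M] (u : Q → M) (hQ : #Q ≤ 𝔠) :
    #(Submodule.span R (Set.range u)) ≤ 𝔠 := by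
  have hfinsupp : #(Q →₀ R) ≤ 𝔠 := by
    cases finite_or_infinite Q
    · exact mk_le_aleph0.trans aleph0_le_continuum
    · cases subsingleton_or_nontrivial R
      · exact mk_le_aleph0.trans aleph0_le_continuum
      · rw [mk_finsupp_lift_of_infinite]
        exact max_le (lift_le_continuum.2 hQ)
          (lift_le_continuum.2 (mk_le_aleph0.trans aleph0_le_continuum))
  have hrange := (mk_range_le_lift (f := Finsupp.linearCombination R u)).trans
    (lift_le_continuum.2 hfinsupp)
  rw [← Finsupp.range_linearCombination]
  exact lift_le_continuum.1 hrange

theorem nonempty_prod_equiv_self {I : Type u} {N : Type v} [Infinite I] [Countable N] [Nonempty N] :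
    Nonempty (I × N ≃ I) := by
  refine lift_mk_eq'.1 ?_
  simp only [mk_prod, lift_mul, lift_lift]
  have hI := aleph0_le_lift.{u, max v u}.2 (aleph0_le_mk I)
  exact Cardinal.mul_eq_left hI ((lift_le_aleph0.2 mk_le_aleph0).trans hI) (by simp)

end Cardinality

section Existence

variable (R L : Type*) [Ring R] [Countable R] [AddCommGroup L] [Module R L] [FaithfulSMul R L]
  [TopologicalSpace L] [T2Space L]

theorem exists_linearIndependent_totallyImperfect_span {Q : Type u} (hQ : #Q ≤ 𝔠) :
    ∃ b : Q → R × Clopens (ℕ → Bool) → L, LinearIndependent R b ∧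
      TotallyImperfect (Submodule.span R (Set.range b) : Set (R × Clopens (ℕ → Bool) → L)) := by
  have exists_smul_ne_zero (r : R) : ∃ x : L, r • x = 0 → r = 0 := by
    by_contra! h
    exact (h 0).2 (FaithfulSMul.eq_of_smul_eq_smul fun x => by rw [(h x).1, zero_smul])
  choose z hz using exists_smul_ne_zero
  have hz' (r : R) (hr : r • z = 0) : r = 0 := hz r (congrFun hr r)
  have : PolishSpace Bool := {}
  have : Uncountable (ℕ → Bool) := by simp [← aleph0_lt_mk_iff, aleph0_lt_continuum]
  obtain ⟨B, hB, hBc⟩ := exists_totallyImperfect_continuum_le_mk (X := ℕ → Bool)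
  obtain ⟨ι⟩ : Nonempty (Q ↪ B) :=
    lift_mk_le'.1 ((lift_le_continuum.2 hQ).trans (continuum_le_lift.2 hBc))
  refine ⟨fun q => diracVec z (ι q).1, ?_, ?_⟩
  · exact (linearIndependent_diracVec hz').comp _ (Subtype.val_injective.comp ι.injective)
  · refine (totallyImperfect_span_diracVec hz' hB).mono (Submodule.span_mono ?_)
    rintro _ ⟨q, rfl⟩
    exact ⟨_, (ι q).2, rfl⟩

variable [Nontrivial L] [SecondCountableTopology L] {I : Type v}

theorem exists_free_submodule_totallyImperfect (hI : ℵ₀ < #I) (hI' : #I ≤ 𝔠) :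
    ∃ D : Submodule R (I → L), IsGδDense (D : Set (I → L)) ∧ #D = 𝔠 ∧
      TotallyImperfect (D : Set (I → L)) ∧ Module.Free R D := by
  let N := R × Clopens (ℕ → Bool)
  have : Uncountable I := aleph0_lt_mk_iff.1 hI
  have : Countable N :=
    have := Clopens.countable_iff_secondCountable (X := ℕ → Bool).2 inferInstance
    inferInstance
  have hQ : #((ℕ → I) × (ℕ → N → L)) ≤ 𝔠 := by
    rw [mk_prod, ← continuum_mul_self]
    exact mul_le_mul' (lift_le_continuum.2 (mk_fun_le_continuum hI'))
      (lift_le_continuum.2 (mk_fun_le_continuum mk_le_continuum_of_secondCountable))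
  obtain ⟨b, hb, hbT⟩ := exists_linearIndependent_totallyImperfect_span R L hQ
  obtain ⟨u, hu, huD, huT⟩ := exists_isGδDense_totallyImperfect_span hb hbT
  obtain ⟨σ⟩ := nonempty_prod_equiv_self (I := I) (N := N)
  let E : (I → N → L) ≃ₗ[R] (I → L) :=
    (LinearEquiv.curry R L I N).symm.trans (LinearEquiv.funCongrLeft R L σ.symm)
  have hE : Continuous E := continuous_pi fun i =>
    (continuous_apply (σ.symm i).2).comp (continuous_apply (σ.symm i).1)
  have hE' : Continuous E.symm :=
    continuous_pi fun i => continuous_pi fun n => continuous_apply (σ (i, n))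
  have hEu : IsGδDense (Submodule.span R (Set.range (E ∘ u)) : Set (I → L)) :=
    (Set.range_comp E u ▸ huD.image hE E.surjective).mono Submodule.subset_span
  refine ⟨Submodule.span R (Set.range (E ∘ u)), hEu,
    (mk_span_range_le_continuum _ hQ).antisymm hEu.continuum_le_mk, ?_,
    .of_basis (Module.Basis.span (hu.map' E.toLinearMap E.ker))⟩
  refine huT.of_injOn hE' (fun x hx => ?_) E.symm.injective.injOn
  rw [Set.range_comp, Submodule.span_image_linearEquiv] at hx
  obtain ⟨y, hy, rfl⟩ := hx
  simpa using hy

theorem exists_free_submodule_not_wCompact (hI : ℵ₀ < #I) (hI' : #I ≤ 𝔠) :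
    ∃ D : Submodule R (I → L), IsGδDense (D : Set (I → L)) ∧ #D = 𝔠 ∧
      (∀ C : Set D, IsCompact C → C.Countable) ∧ ¬ WCompact D ∧ Module.Free R D := by
  obtain ⟨D, hD, hDc, hDT, hDf⟩ := exists_free_submodule_totallyImperfect R L hI hI'
  have : Uncountable I := aleph0_lt_mk_iff.1 hI
  have hcountable (C : Set D) (hC : IsCompact C) : C.Countable := hDT.countable_of_isCompact hC
  have hnot : ¬ SecondCountableTopology D := fun _ => hD.not_firstCountableTopology inferInstance
  exact ⟨D, hD, hDc, hcountable, not_wCompact_of_not_secondCountableTopology hcountable hnot, hDf⟩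

end Existence

theorem faithfulSMul_int_of_not_exponentExists {L : Type*} [AddCommGroup L]
    (hL : ¬ AddMonoid.ExponentExists L) : FaithfulSMul ℤ L := by
  refine Module.annihilator_eq_bot.1 ((Submodule.eq_bot_iff _).2 fun r hr => ?_)
  by_contra hr0
  exact hL ⟨r.natAbs, Int.natAbs_pos.2 hr0, fun x =>
    natAbs_nsmul_eq_zero.2 (Module.mem_annihilator.1 hr x)⟩

theorem corollary5p4_general {L : Type u} [AddCommGroup L] [TopologicalSpace L] [T2Space L]
    [SecondCountableTopology L] [Nontrivial L] {I : Type v} (hI : ℵ₀ < #I) (hI' : #I ≤ 𝔠) :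
    (∃ D : AddSubgroup (I → L),
      IsGδDense (D : Set (I → L)) ∧ #D = 𝔠 ∧
      (∀ C : Set D, IsCompact C → C.Countable) ∧ ¬ WCompact D) ∧
    (¬ AddMonoid.ExponentExists L →
      ∃ D : AddSubgroup (I → L),
        IsGδDense (D : Set (I → L)) ∧ #D = 𝔠 ∧
        (∀ C : Set D, IsCompact C → C.Countable) ∧ ¬ WCompact D ∧ Module.Free ℤ D) := by
  constructor
  · let R := (Int.castRingHom (AddMonoid.End L)).range
    have : Countable R := (Int.castRingHom _).rangeRestrict_surjective.countable
    obtain ⟨D, hD, hDc, hDC, hDw, -⟩ := exists_free_submodule_not_wCompact R L hI hI'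
    exact ⟨D.toAddSubgroup, hD, hDc, hDC, hDw⟩
  · intro hL
    have := faithfulSMul_int_of_not_exponentExists hL
    obtain ⟨D, hD⟩ := exists_free_submodule_not_wCompact ℤ L hI hI'
    exact ⟨D.toAddSubgroup, hD⟩

theorem corollary5p4 {L : Type u} [AddCommGroup L] [TopologicalSpace L] [IsTopologicalAddGroup L]
    [CompactSpace L] [MetrizableSpace L] [Nontrivial L]
    {I : Type v} (hI : ℵ₀ < #I) (hI' : #I ≤ 𝔠) :
    (∃ D : AddSubgroup (I → L),
      IsGδDense (D : Set (I → L)) ∧ #D = 𝔠 ∧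
      (∀ C : Set D, IsCompact C → C.Countable) ∧ ¬ WCompact D) ∧
    (¬ AddMonoid.ExponentExists L →
      ∃ D : AddSubgroup (I → L),
        IsGδDense (D : Set (I → L)) ∧ #D = 𝔠 ∧
        (∀ C : Set D, IsCompact C → C.Countable) ∧ ¬ WCompact D ∧ Module.Free ℤ D) := by
  let _ := metrizableSpaceMetric L
  exact corollary5p4_general hI hI'
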